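/- Let $n\ge 0$ and $m\ge 1$ be integers and let $\rho$ be a positive real number. The algorithm Bricks, given the number $n$ of bricks (jobs of unit processing time), the number $m$ of machines, the number $b$ of bags and the desired robustness factor $\rho$, starts with $c=n$ coins and performs $b$ rounds. In round $j$ (for $j=1,\dots,b$) it sets $z=\lceil c/m\rceil$ (the cost of the bag), creates a bag of size $a_j=\lfloor z\rho\rfloor$, and replaces $c$ by $c-z$. It returns the bag sizes $a_1,\dots,a_b$. Theorem. Let $\rho=1.6$ and $b=m$, and suppose that $\lambda=n/m\le 60$. Then the algorithm Bricks succeeds, i.e., it outputs bags of total size at least $n$: $$\sum_{j=1}^{m} a_j\ \ge\ n .$$ -/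

import Mathlib

/-- The cost `⌈c / m⌉` of the next bag when `c` coins remain and there are `m` machines. -/
def bagCost (m : ℕ) (c : ℤ) : ℤ := ⌈(c : ℚ) / (m : ℚ)⌉

/-- The `for` loop of the algorithm Bricks with `m` machines and desired robustness factor `ρ`:
the list of the sizes of the bags that are created in the next `b` rounds when `c` coins remain.
In each round the cost `z = ⌈c / m⌉` is paid and a bag of size `⌊z * ρ⌋` is created. -/
noncomputable def bricksLoop (m : ℕ) (ρ : ℝ) : (b : ℕ) → (c : ℤ) → List ℤ
  | 0, _ => []
  | b + 1, c => ⌊(bagCost m c : ℝ) * ρ⌋ :: bricksLoop m ρ b (c - bagCost m c)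

/-- The bag sizes `a₁, …, a_b` returned by the algorithm Bricks for `n` bricks, `m` machines,
`b` bags and desired robustness factor `ρ`; the initial number of coins is `n`. -/
noncomputable def bricks (n m b : ℕ) (ρ : ℝ) : List ℤ := bricksLoop m ρ b (n : ℤ)

/-- The algorithm Bricks is successful if it outputs bags of total size at least `n`. -/
def BricksSucceeds (n m b : ℕ) (ρ : ℝ) : Prop := (n : ℤ) ≤ (bricks n m b ρ).sum

/-- The size of a bag of cost `z` for the robustness factor `8 / 5`. -/
def bagSize (z : ℕ) : ℕ := 8 * z / 5

theorem bagSize_mono {y z : ℕ} (h : y ≤ z) : bagSize y ≤ bagSize z := by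
  unfold bagSize; omega

/-- The level of the `c`-th coin, i.e. `⌈c / m⌉` in natural number arithmetic. -/
def level (m c : ℕ) : ℕ := (c + m - 1) / m

theorem level_le_self {m : ℕ} (hm : 0 < m) (c : ℕ) : level m c ≤ c := by
  unfold level
  rw [← Nat.lt_succ_iff, Nat.div_lt_iff_lt_mul hm]
  have := Nat.mul_le_mul_left c hm
  rw [Nat.succ_eq_add_one, add_mul]
  omega

theorem level_le_iff {m : ℕ} (hm : 0 < m) (c q : ℕ) : level m c ≤ q ↔ c ≤ q * m := by
  unfold level
  rw [← Nat.lt_succ_iff, Nat.div_lt_iff_lt_mul hm, Nat.succ_eq_add_one, add_mul]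
  omega

theorem div_add_one_le_level {m : ℕ} (hm : 0 < m) {i c : ℕ} (h : i < c) :
    i / m + 1 ≤ level m c := by
  unfold level
  rw [← Nat.add_div_right _ hm]
  exact Nat.div_le_div_right (by omega)

/-- The total size of the bags created by `b` rounds of Bricks from `c` coins on `m` machines. -/
def totalSize (m : ℕ) : (b : ℕ) → (c : ℕ) → ℕ
  | 0, _ => 0
  | b + 1, c => bagSize (level m c) + totalSize m b (c - level m c)

theorem bagCost_natCast {m : ℕ} (hm : 0 < m) (c : ℕ) : bagCost m (c : ℤ) = (level m c : ℤ) := by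
  have hm' : (0 : ℚ) < m := by exact_mod_cast hm
  unfold bagCost
  apply eq_of_forall_ge_iff
  intro q
  rw [Int.ceil_le, div_le_iff₀ hm']
  rcases lt_or_ge q 0 with hq | hq
  · constructor
    · intro h
      have h1 : (q : ℚ) * m < 0 := mul_neg_of_neg_of_pos (by exact_mod_cast hq) hm'
      have h2 : (0 : ℚ) ≤ ((c : ℤ) : ℚ) := by exact_mod_cast Nat.zero_le c
      linarith
    · intro h
      omega
  · lift q to ℕ using hq
    rw [Nat.cast_le, level_le_iff hm]
    norm_cast

theorem floor_natCast_mul (z : ℕ) : ⌊(((z : ℤ)) : ℝ) * 1.6⌋ = (bagSize z : ℤ) := by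
  have h : (((z : ℤ)) : ℝ) * 1.6 = ((8 * z : ℕ) : ℝ) / ((5 : ℕ) : ℝ) := by
    push_cast; ring
  rw [h, Int.floor_div_natCast, Int.floor_natCast, bagSize, Int.natCast_ediv]

theorem sum_bricksLoop {m : ℕ} (hm : 0 < m) (b c : ℕ) :
    (bricksLoop m 1.6 b (c : ℤ)).sum = (totalSize m b c : ℤ) := by
  induction b generalizing c with
  | zero => simp [bricksLoop, totalSize]
  | succ b ih =>
    rw [bricksLoop, totalSize, List.sum_cons, bagCost_natCast hm, floor_natCast_mul,
      ← Nat.cast_sub (level_le_self hm c), ih, Nat.cast_add]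

/-- The minimum of `f L, f (L - 1), …, f (L - d)`. -/
def tailMin (f : ℕ → ℕ) (L : ℕ) : ℕ → ℕ
  | 0 => f L
  | d + 1 => min (tailMin f L d) (f (L - (d + 1)))

theorem tailMin_antitone (f : ℕ → ℕ) (L : ℕ) : Antitone (tailMin f L) :=
  antitone_nat_of_succ_le fun _ => min_le_left _ _

theorem tailMin_le (f : ℕ → ℕ) (L d : ℕ) : tailMin f L d ≤ f (L - d) := by
  cases d with
  | zero => exact le_rfl
  | succ d => exact min_le_right _ _

/-- A value (in thousandths) of a coin of level `z ≤ 60`, nondecreasing in `z`, such that `z` coins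
of level `z` are worth at most the excess of a bag of cost `z` over a bag of cost `k`. -/
def coinValue (k z : ℕ) : ℕ :=
  tailMin (fun w => 1000 * (bagSize w - bagSize k) / w) 60 (60 - z)

theorem coinValue_mono (k : ℕ) : Monotone (coinValue k) := fun _ _ h =>
  tailMin_antitone _ _ (Nat.sub_le_sub_left h 60)

theorem mul_coinValue_le {k z : ℕ} (hz : z ≤ 60) :
    z * coinValue k z ≤ 1000 * (bagSize z - bagSize k) := by
  have h := tailMin_le (fun w => 1000 * (bagSize w - bagSize k) / w) 60 (60 - z)
  rw [Nat.sub_sub_self hz] at h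
  exact (Nat.mul_le_mul_left z h).trans (Nat.mul_div_le _ _)

theorem coinValue_eq_zero {k z : ℕ} (hzk : z ≤ k) (hk : k ≤ 60) : coinValue k z = 0 := by
  have h := tailMin_le (fun w => 1000 * (bagSize w - bagSize k) / w) 60 (60 - z)
  rw [Nat.sub_sub_self (hzk.trans hk)] at h
  simpa [coinValue, Nat.sub_eq_zero_of_le (bagSize_mono hzk)] using h

/-- The total value of the first `c` coins. -/
def coinsValue (k m c : ℕ) : ℕ := ∑ i ∈ Finset.range c, coinValue k (i / m + 1)

theorem coinsValue_eq_zero {m : ℕ} (hm : 0 < m) {k c : ℕ} (hck : level m c ≤ k) (hk : k ≤ 60) :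
    coinsValue k m c = 0 :=
  Finset.sum_eq_zero fun _ hi =>
    coinValue_eq_zero ((div_add_one_le_level hm (Finset.mem_range.1 hi)).trans hck) hk

/-- The coins spent on a bag of cost `z` are the `z` top ones, all of level at most `z`; by
monotonicity each is worth at most `coinValue k z`. -/
theorem coinsValue_le {m : ℕ} (hm : 0 < m) (k : ℕ) {c : ℕ} (hc : level m c ≤ 60) :
    coinsValue k m c ≤
      coinsValue k m (c - level m c) + 1000 * (bagSize (level m c) - bagSize k) := by
  have hsplit := Finset.sum_range_add_sum_Ico (fun i => coinValue k (i / m + 1))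
    (Nat.sub_le c (level m c))
  have hIco : ∑ i ∈ Finset.Ico (c - level m c) c, coinValue k (i / m + 1) ≤
      level m c * coinValue k (level m c) := by
    refine (Finset.sum_le_card_nsmul _ _ (coinValue k (level m c)) fun i hi =>
      coinValue_mono k (div_add_one_le_level hm (Finset.mem_Ico.1 hi).2)).trans_eq ?_
    rw [Nat.card_Ico, Nat.sub_sub_self (level_le_self hm c), smul_eq_mul]
  rw [coinsValue, ← hsplit]
  exact Nat.add_le_add_left (hIco.trans (mul_coinValue_le hc)) _

/-- The total size is at least one of the values `b * bagSize k + coinsValue k m c / 1000`. -/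
theorem exists_le_totalSize {m : ℕ} (hm : 0 < m) (b c : ℕ) (hc : level m c ≤ 60) :
    ∃ k ≤ 60, 1000 * (b * bagSize k) + coinsValue k m c ≤ 1000 * totalSize m b c := by
  induction b generalizing c with
  -- With no bags left, 60 serves as a threshold above which no coin lies.
  | zero => exact ⟨60, le_rfl, by simp [coinsValue_eq_zero hm hc]⟩
  | succ b ih =>
    have hc' : level m (c - level m c) ≤ 60 :=
      (level_le_iff hm _ _).2 ((Nat.sub_le _ _).trans ((level_le_iff hm _ _).1 hc))
    obtain ⟨k, hk, h⟩ := ih _ hc'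
    rw [totalSize]
    rcases le_total k (level m c) with hkz | hzk
    · refine ⟨k, hk, ?_⟩
      have h1 := coinsValue_le hm k hc
      have h2 := bagSize_mono hkz
      rw [add_mul]
      omega
    -- Lowering the threshold to the current cost makes every coin worthless, and each later bag is
    -- still counted with at most its former bound.
    · refine ⟨level m c, hc, ?_⟩
      have h1 := Nat.mul_le_mul_left b (bagSize_mono hzk)
      rw [coinsValue_eq_zero hm le_rfl hc, add_mul]
      omega

/-- The only place where the numbers 1.6 and 60 have to fit together; rounding to thousandths keeps
the check in natural numbers. -/
theorem sum_sub_coinValue_le :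
    ∀ k < 61, ∑ z ∈ Finset.range 60, (1000 - coinValue k (z + 1)) ≤ 1000 * bagSize k := by
  decide +kernel

theorem sum_range_mul_div {m : ℕ} (hm : 0 < m) (f : ℕ → ℕ) (q : ℕ) :
    ∑ i ∈ Finset.range (q * m), f (i / m) = m * ∑ z ∈ Finset.range q, f z := by
  induction q with
  | zero => simp
  | succ q ih =>
    rw [add_mul, one_mul, Finset.sum_range_add, ih, Finset.sum_range_succ, mul_add]
    congr 1
    rw [Finset.sum_congr rfl (g := fun _ => f q), Finset.sum_const, Finset.card_range, smul_eq_mul]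
    intro i hi
    rw [mul_comm, Nat.mul_add_div hm, Nat.div_eq_of_lt (Finset.mem_range.1 hi), add_zero]

theorem le_mul_bagSize_add_coinsValue {n m k : ℕ} (hm : 0 < m) (hn : n ≤ 60 * m) (hk : k ≤ 60) :
    1000 * n ≤ 1000 * (m * bagSize k) + coinsValue k m n := by
  have h1 : 1000 * n ≤
      ∑ i ∈ Finset.range n, (1000 - coinValue k (i / m + 1)) + coinsValue k m n := by
    rw [coinsValue, ← Finset.sum_add_distrib]
    calc 1000 * n = ∑ i ∈ Finset.range n, 1000 := by simp [mul_comm]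
      _ ≤ _ := Finset.sum_le_sum fun i _ => by omega
  -- Truncated subtraction keeps all terms nonnegative, so the worst case is `n = 60 * m`, with `m`
  -- coins on each level.
  have h2 : ∑ i ∈ Finset.range n, (1000 - coinValue k (i / m + 1)) ≤
      ∑ i ∈ Finset.range (60 * m), (1000 - coinValue k (i / m + 1)) :=
    Finset.sum_le_sum_of_subset (Finset.range_mono hn)
  rw [sum_range_mul_div hm (fun z => 1000 - coinValue k (z + 1))] at h2
  have h3 := Nat.mul_le_mul_left m (sum_sub_coinValue_le k (by omega))
  rw [mul_left_comm] at h3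
  omega

theorem mainTheorem6 (n m : ℕ) (hm : 0 < m) (hlam : (n : ℝ) / (m : ℝ) ≤ 60) :
    BricksSucceeds n m m 1.6 := by
  have hn : n ≤ 60 * m := by
    rw [div_le_iff₀ (by exact_mod_cast hm)] at hlam
    exact_mod_cast hlam
  rw [BricksSucceeds, bricks, sum_bricksLoop hm, Nat.cast_le]
  obtain ⟨k, hk, h⟩ := exists_le_totalSize hm m n ((level_le_iff hm n 60).2 hn)
  have := le_mul_bagSize_add_coinsValue hm hn hk
  omega
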